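/- Let $[n]=\{1,\dots,n\}$. A set partition of $[n]$ is a collection of pairwise disjoint nonempty subsets (blocks) of $[n]$ with union $[n]$. A family $\mathcal{A}$ of set partitions of $[n]$ is $t$-intersecting if $|P\cap Q|\ge t$ for all $P,Q\in\mathcal{A}$, i.e. any two members have at least $t$ blocks in common; it is trivially $t$-intersecting if there are $t$ distinct elements $x_1,\dots,x_t\in[n]$ such that $\{x_1\},\dots,\{x_t\}$ are blocks of every member of $\mathcal{A}$; and it is non-trivially $t$-intersecting (or a non-trivial $t$-intersecting family) if it is $t$-intersecting but not trivially so. For distinct $i,j\in[n]$ and a set partition $P$ of $[n]$, let $P_{[i]}$ be the block of $P$ containing $i$, and put $$s_{ij}(P)=\begin{cases}\bigl(P\setminus\{P_{[i]}\}\bigr)\cup\{\{i\},\,P_{[i]}\setminus\{i\}\} & \text{if } j\in P_{[i]},\\ P & \text{otherwise.}\end{cases}$$ For a family $\mathcal{A}$ let $\mathcal{A}_{ij}=\{P\in\mathcal{A}: s_{ij}(P)\notin\mathcal{A}\}$ and $S_{ij}(\mathcal{A})=(\mathcal{A}\setminus\mathcal{A}_{ij})\cup\{s_{ij}(P):P\in\mathcal{A}_{ij}\}$.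 The family $\mathcal{A}$ is compressed if $S_{ij}(\mathcal{A})=\mathcal{A}$ for all distinct $i,j\in[n]$. Theorem 3.6. For every integer $t\ge 1$ there is $n_0(t)$ such that for all $n\ge n_0(t)$ the following holds. Let $\mathcal{A}$ be a non-trivial $t$-intersecting family of set partitions of $[n]$ that has maximum size among all non-trivial $t$-intersecting families of set partitions of $[n]$. If $\mathcal{A}$ is not compressed, then there exist distinct $k,l\in[n]$ such that $S_{kl}(\mathcal{A})\ne\mathcal{A}$ and $S_{kl}(\mathcal{A})$ is non-trivially $t$-intersecting. -/

import Mathlib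

/-- Set partitions of an `n`-element ground set (`Fin n` plays the role of `{1, …, n}`); the blocks
of `P` are the elements of `P.parts`. -/
abbrev SetPartition (n : ℕ) : Type := Finpartition (Finset.univ : Finset (Fin n))

namespace SetPartition

variable {n : ℕ}

/-- If `j ≠ i` lies in the block of `i`, replace that block `B` by the two blocks `{i}` and
`B \ {i}`. -/
def splitBlock (i j : Fin n) (P : SetPartition n) (hij : i ≠ j) (hj : j ∈ P.part i) :
    SetPartition n :=
  Finpartition.ofExistsUnique
    (P.parts \ {P.part i} ∪ {{i}, P.part i \ {i}})
    (fun p _ => Finset.subset_univ p)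
    (by
      intro a _
      have ha : a ∈ P.part a := P.mem_part_self.2 (Finset.mem_univ a)
      have hi : i ∈ P.part i := P.mem_part_self.2 (Finset.mem_univ i)
      have hPa : P.part a ∈ P.parts := P.part_mem.2 (Finset.mem_univ a)
      have hPi : P.part i ∈ P.parts := P.part_mem.2 (Finset.mem_univ i)
      have key : ∀ t ∈ P.parts, a ∈ t → t = P.part a :=
        fun t ht hat => (P.part_eq_of_mem ht hat).symm
      have keyi : a ∈ P.part i → P.part i = P.part a := key _ hPi
      simp only [Finset.mem_union, Finset.mem_sdiff, Finset.mem_insert, Finset.mem_singleton]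
      by_cases hai : a = i
      · subst hai
        refine ⟨{a}, ⟨Or.inr (Or.inl rfl), by simp⟩, ?_⟩
        rintro t ⟨⟨ht, hne⟩ | rfl | rfl, hat⟩
        · exact absurd (key t ht hat) hne
        · rfl
        · simp at hat
      · by_cases hap : a ∈ P.part i
        · refine ⟨P.part i \ {i}, ⟨Or.inr (Or.inr rfl), by simp [hap, hai]⟩, ?_⟩
          rintro t ⟨⟨ht, hne⟩ | rfl | rfl, hat⟩
          · exact absurd ((key t ht hat).trans (keyi hap).symm) hne
          · exact absurd (Finset.mem_singleton.1 hat) hai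
          · rfl
        · refine ⟨P.part a, ⟨Or.inl ⟨hPa, fun h => hap (h ▸ ha)⟩, ha⟩, ?_⟩
          rintro t ⟨⟨ht, hne⟩ | rfl | rfl, hat⟩
          · exact key t ht hat
          · exact absurd (Finset.mem_singleton.1 hat) hai
          · exact absurd (Finset.mem_sdiff.1 hat).1 hap)
    (by
      simp only [Finset.mem_union, Finset.mem_sdiff, Finset.mem_insert, Finset.mem_singleton]
      rintro (⟨h, -⟩ | h | h)
      · exact P.empty_notMem_parts h
      · exact Finset.singleton_ne_empty i h.symm
      · have : j ∈ P.part i \ {i} := by simp [hj, hij.symm]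
        rw [← h] at this
        simp at this)

/-- The `(i,j)`-split `s_{ij}(P)`. It is only used for `i ≠ j`; for `i = j` it returns `P`. -/
def split (i j : Fin n) (P : SetPartition n) : SetPartition n :=
  if h : i ≠ j ∧ j ∈ P.part i then splitBlock i j P h.1 h.2 else P

/-- `𝒜_{ij}`: the members of `𝒜` whose `(i,j)`-split is not in `𝒜`. -/
def movable (i j : Fin n) (𝒜 : Finset (SetPartition n)) : Finset (SetPartition n) :=
  𝒜.filter fun P => split i j P ∉ 𝒜

/-- The `(i,j)`-splitting `S_{ij}(𝒜) = (𝒜 \ 𝒜_{ij}) ∪ s_{ij}(𝒜_{ij})`. -/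
def splitting (i j : Fin n) (𝒜 : Finset (SetPartition n)) : Finset (SetPartition n) :=
  (𝒜 \ movable i j 𝒜) ∪ (movable i j 𝒜).image (split i j)

/-- Compressed: fixed by all splitting operations. -/
def IsCompressed (𝒜 : Finset (SetPartition n)) : Prop :=
  ∀ i j : Fin n, i ≠ j → splitting i j 𝒜 = 𝒜

/-- `t`-intersecting: any two members have at least `t` blocks in common. -/
def IsIntersecting (t : ℕ) (𝒜 : Finset (SetPartition n)) : Prop :=
  ∀ P ∈ 𝒜, ∀ Q ∈ 𝒜, t ≤ (P.parts ∩ Q.parts).card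

/-- Trivial: there are `t` fixed singletons that are blocks of all members. -/
def IsTrivial (t : ℕ) (𝒜 : Finset (SetPartition n)) : Prop :=
  ∃ T : Finset (Fin n), T.card = t ∧ ∀ P ∈ 𝒜, ∀ x ∈ T, {x} ∈ P.parts

/-- Non-trivial `t`-intersecting families. -/
def IsNontrivialIntersecting (t : ℕ) (𝒜 : Finset (SetPartition n)) : Prop :=
  IsIntersecting t 𝒜 ∧ ¬ IsTrivial t 𝒜

/-- Non-trivial `t`-intersecting families of maximum size among all such families of set
partitions of the same ground set. -/
def IsMaxNontrivialIntersecting (t : ℕ) (𝒜 : Finset (SetPartition n)) : Prop :=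
  IsNontrivialIntersecting t 𝒜 ∧
    ∀ ℬ : Finset (SetPartition n), IsNontrivialIntersecting t ℬ → ℬ.card ≤ 𝒜.card

end SetPartition

namespace SetPartition

open Finset

variable {n : ℕ}

/-! Splitting preserves size and the `t`-intersecting property, so if the theorem fails, every
splitting that changes `𝒜` makes it trivial. Let `F` be the number of partitions with `t + 1`
prescribed singletons. Maximality gives `2F < |𝒜|` (`exists_large_nontrivialIntersecting`), and the
contradiction comes from bounding `|𝒜|` by `2F`.

Suppose splitting at `i, j` changes `𝒜`, with singletons `T` fixed afterwards. Each member has the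
singletons `T` or joins `i` to `j`, and `T` contains `i` or `j`. For `k` outside `T ∪ {i, j}`, a
splitting off `k` that changed `𝒜` would force `|𝒜| ≤ 2F` (`card_le_of_isTrivial_splitting`), so `𝒜`
is closed under splitting off such `k`.

Closure yields a member whose only non-singleton block is `{i, j}`. This member is movable, so `⊥ ∉
𝒜`. A member with the singletons `T` could be split down to `⊥`, hence all members join `i` to `j`.
By maximality some member meets `⊥` in fewer than `t` blocks, and then `card_le_of_closed_of_joined`
gives `|𝒜| ≤ F`. -/

/-! ### Blocks, singletons and the partition `⊥` -/

theorem self_mem_part (P : SetPartition n) (x : Fin n) : x ∈ P.part x :=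
  P.mem_part_self.2 (mem_univ x)

theorem part_mem_parts (P : SetPartition n) (x : Fin n) : P.part x ∈ P.parts :=
  P.part_mem.2 (mem_univ x)

theorem part_eq_part_iff (P : SetPartition n) {x y : Fin n} :
    P.part x = P.part y ↔ y ∈ P.part x := by
  rw [P.part_eq_iff_mem (part_mem_parts P y), P.mem_part_iff_part_eq_part (mem_univ _) (mem_univ _),
    P.mem_part_iff_part_eq_part (mem_univ _) (mem_univ _), eq_comm]

theorem singleton_mem_parts_iff (P : SetPartition n) {x : Fin n} :
    {x} ∈ P.parts ↔ P.part x = {x} :=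
  ⟨fun h => P.part_eq_of_mem h (mem_singleton_self x), fun h => h ▸ part_mem_parts P x⟩

theorem singleton_mem_parts_iff_forall (P : SetPartition n) {x : Fin n} :
    {x} ∈ P.parts ↔ ∀ y ∈ P.part x, y = x := by
  rw [singleton_mem_parts_iff]
  refine ⟨fun h y hy => by simpa [h] using hy, fun h => ?_⟩
  exact Finset.eq_singleton_iff_unique_mem.2 ⟨self_mem_part P x, h⟩

theorem ext_of_part {P Q : SetPartition n} (h : ∀ x y, y ∈ P.part x ↔ y ∈ Q.part x) : P = Q := by
  have h' : ∀ x, P.part x = Q.part x := fun x => by ext y; exact h x y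
  ext C
  constructor
  · intro hC
    obtain ⟨x, hx⟩ := P.nonempty_of_mem_parts hC
    rw [← P.part_eq_of_mem hC hx, h']
    exact part_mem_parts Q x
  · intro hC
    obtain ⟨x, hx⟩ := Q.nonempty_of_mem_parts hC
    rw [← Q.part_eq_of_mem hC hx, ← h']
    exact part_mem_parts P x

theorem eq_bot_iff_singletons {P : SetPartition n} : P = ⊥ ↔ ∀ x, {x} ∈ P.parts := by
  constructor
  · rintro rfl x
    exact Finpartition.mem_bot_iff.2 ⟨x, mem_univ x, rfl⟩
  · intro h
    refine ext_of_part fun x y => ?_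
    have h2 : {x} ∈ (⊥ : SetPartition n).parts := Finpartition.mem_bot_iff.2 ⟨x, mem_univ x, rfl⟩
    rw [(singleton_mem_parts_iff _).1 (h x), (singleton_mem_parts_iff _).1 h2]

theorem eq_bot_of_singletons_off {P : SetPartition n} (y : Fin n)
    (h : ∀ x, x ≠ y → {x} ∈ P.parts) : P = ⊥ := by
  refine eq_bot_iff_singletons.2 fun x => ?_
  by_cases hxy : x = y
  · subst hxy
    refine (singleton_mem_parts_iff_forall P).2 fun z hz => ?_
    by_contra hzx
    have := P.eq_of_mem_parts (h z hzx) (part_mem_parts P x) (mem_singleton_self z) hz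
    have hx := self_mem_part P x
    rw [← this, mem_singleton] at hx
    exact hzx hx.symm
  · exact h x hxy

/-! ### Splitting a partition -/

theorem split_of_notMem {i j : Fin n} {P : SetPartition n} (h : j ∉ P.part i) :
    split i j P = P := by
  simp [split, h]

theorem mem_parts_split {i j : Fin n} {P : SetPartition n} (hij : i ≠ j) (h : j ∈ P.part i)
    {C : Finset (Fin n)} :
    C ∈ (split i j P).parts ↔ (C ∈ P.parts ∧ C ≠ P.part i) ∨ C = {i} ∨ C = P.part i \ {i} := by
  simp only [split, ne_eq, hij, not_false_eq_true, h, and_self, dite_true, splitBlock,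
    Finpartition.ofExistsUnique_parts, mem_union, mem_sdiff, mem_insert, mem_singleton]

theorem singleton_notMem_of_mem_part {i j : Fin n} {P : SetPartition n} (hij : i ≠ j)
    (h : j ∈ P.part i) : {i} ∉ P.parts := fun hi =>
  hij.symm ((singleton_mem_parts_iff_forall P).1 hi j h)

theorem mem_part_comm {P : SetPartition n} {x y : Fin n} : y ∈ P.part x ↔ x ∈ P.part y := by
  rw [← part_eq_part_iff, ← part_eq_part_iff, eq_comm]

theorem singleton_mem_split {i j x : Fin n} {P : SetPartition n} (hij : i ≠ j)
    (hx : {x} ∈ P.parts) : {x} ∈ (split i j P).parts := by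
  by_cases h : j ∈ P.part i
  · rw [mem_parts_split hij h]
    refine Or.inl ⟨hx, fun e => ?_⟩
    have h1 := self_mem_part P i
    rw [← e, mem_singleton] at h h1
    exact hij (h1.trans h.symm)
  · rwa [split_of_notMem h]

theorem singleton_mem_split_self {i j : Fin n} {P : SetPartition n} (hij : i ≠ j)
    (h : j ∈ P.part i) : {i} ∈ (split i j P).parts :=
  (mem_parts_split hij h).2 (Or.inr (Or.inl rfl))

theorem singleton_mem_of_split {i j x : Fin n} {P : SetPartition n} (hij : i ≠ j)
    (hi : x ≠ i) (hj : x ≠ j) (hx : {x} ∈ (split i j P).parts) : {x} ∈ P.parts := by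
  by_cases h : j ∈ P.part i
  · rcases (mem_parts_split hij h).1 hx with h1 | h1 | h1
    · exact h1.1
    · exact absurd (singleton_injective h1) hi
    · have : j ∈ P.part i \ {i} := by simp [h, hij.symm]
      rw [← h1, mem_singleton] at this
      exact absurd this.symm hj
  · rwa [split_of_notMem h] at hx

theorem part_split_of_mem {i j : Fin n} {P : SetPartition n} (hij : i ≠ j)
    (h : j ∈ P.part i) : (split i j P).part j = P.part i \ {i} :=
  Finpartition.part_eq_of_mem _ ((mem_parts_split hij h).2 (Or.inr (Or.inr rfl)))
    (by simp [h, hij.symm])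

theorem mem_part_split {i j x y : Fin n} {P : SetPartition n} (hij : i ≠ j)
    (hx : x ≠ i) (hy : y ≠ i) : y ∈ (split i j P).part x ↔ y ∈ P.part x := by
  by_cases h : j ∈ P.part i
  · rw [Finpartition.mem_part_iff_exists, Finpartition.mem_part_iff_exists]
    constructor
    · rintro ⟨C, hC, hyC, hxC⟩
      rcases (mem_parts_split hij h).1 hC with h1 | rfl | rfl
      · exact ⟨C, h1.1, hyC, hxC⟩
      · exact absurd (mem_singleton.1 hxC) hx
      · exact ⟨_, part_mem_parts P i, (mem_sdiff.1 hyC).1, (mem_sdiff.1 hxC).1⟩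
    · rintro ⟨C, hC, hyC, hxC⟩
      by_cases hCi : C = P.part i
      · subst hCi
        exact ⟨_, (mem_parts_split hij h).2 (Or.inr (Or.inr rfl)), by simp [hyC, hy],
          by simp [hxC, hx]⟩
      · exact ⟨C, (mem_parts_split hij h).2 (Or.inl ⟨hC, hCi⟩), hyC, hxC⟩
  · rw [split_of_notMem h]

/-- A split is undone by putting `i` back into the block of `j`. This is what makes splitting
injective on partitions joining `i` to `j`. -/
theorem mem_parts_iff_of_split {i j : Fin n} {P : SetPartition n} (hij : i ≠ j)
    (h : j ∈ P.part i) {C : Finset (Fin n)} :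
    C ∈ P.parts ↔ C = insert i ((split i j P).part j) ∨
      (C ∈ (split i j P).parts ∧ C ≠ {i} ∧ C ≠ (split i j P).part j) := by
  have hi := self_mem_part P i
  have e : insert i (P.part i \ {i}) = P.part i := by
    rw [sdiff_singleton_eq_erase, insert_erase hi]
  rw [part_split_of_mem hij h, e, mem_parts_split hij h]
  constructor
  · intro hC
    by_cases hCi : C = P.part i
    · exact Or.inl hCi
    · refine Or.inr ⟨Or.inl ⟨hC, hCi⟩, ?_, ?_⟩
      · rintro rfl
        exact singleton_notMem_of_mem_part hij h hC
      · rintro rfl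
        exact hCi (P.eq_of_mem_parts hC (part_mem_parts P i) (a := j) (by simp [h, hij.symm]) h)
  · rintro (rfl | ⟨h1 | h1 | h1, h2, h3⟩)
    · exact part_mem_parts P i
    · exact h1.1
    · exact absurd h1 h2
    · exact absurd h1 h3

theorem split_injOn {i j : Fin n} (hij : i ≠ j) :
    Set.InjOn (split i j) {P : SetPartition n | j ∈ P.part i} := by
  intro P hP Q hQ e
  ext C
  rw [mem_parts_iff_of_split hij hP, mem_parts_iff_of_split hij hQ, e]

/-! ### Splitting a family -/

theorem mem_movable {i j : Fin n} {𝒜 : Finset (SetPartition n)} {P : SetPartition n} :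
    P ∈ movable i j 𝒜 ↔ P ∈ 𝒜 ∧ split i j P ∉ 𝒜 := by
  simp [movable]

theorem mem_part_of_mem_movable {i j : Fin n} {𝒜 : Finset (SetPartition n)} {P : SetPartition n}
    (h : P ∈ movable i j 𝒜) : j ∈ P.part i := by
  rw [mem_movable] at h
  by_contra hj
  rw [split_of_notMem hj] at h
  exact h.2 h.1

theorem mem_splitting {i j : Fin n} {𝒜 : Finset (SetPartition n)} {P : SetPartition n} :
    P ∈ splitting i j 𝒜 ↔ (P ∈ 𝒜 ∧ split i j P ∈ 𝒜) ∨ ∃ Q ∈ movable i j 𝒜, split i j Q = P := by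
  simp only [splitting, mem_union, mem_sdiff, mem_image, mem_movable]
  tauto

theorem card_splitting {i j : Fin n} (hij : i ≠ j) (𝒜 : Finset (SetPartition n)) :
    (splitting i j 𝒜).card = 𝒜.card := by
  rw [splitting, card_union_of_disjoint, card_image_of_injOn]
  · exact card_sdiff_add_card_eq_card (filter_subset _ _)
  · exact (split_injOn hij).mono fun P hP => mem_part_of_mem_movable hP
  · rw [disjoint_left]
    intro P hP hP'
    obtain ⟨Q, hQ, rfl⟩ := mem_image.1 hP'
    exact (mem_movable.1 hQ).2 (mem_sdiff.1 hP).1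

theorem split_mem_of_splitting_eq {i j : Fin n} {𝒜 : Finset (SetPartition n)}
    (h : splitting i j 𝒜 = 𝒜) {P : SetPartition n} (hP : P ∈ 𝒜) : split i j P ∈ 𝒜 := by
  by_contra hs
  apply hs
  nth_rewrite 1 [← h]
  exact mem_splitting.2 (Or.inr ⟨P, mem_movable.2 ⟨hP, hs⟩, rfl⟩)

theorem exists_mem_movable_of_splitting_ne {i j : Fin n} {𝒜 : Finset (SetPartition n)}
    (h : splitting i j 𝒜 ≠ 𝒜) : ∃ P, P ∈ movable i j 𝒜 := by
  by_contra! hm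
  refine h ?_
  simp [splitting, eq_empty_of_forall_notMem hm]

/-- The only block lost from `P` contains both `i` and `j`, so it is not a block of `Q`. -/
theorem inter_subset_split_inter {i j : Fin n} {P Q : SetPartition n} (hij : i ≠ j)
    (hP : j ∈ P.part i) (hQ : j ∉ Q.part i) :
    P.parts ∩ Q.parts ⊆ (split i j P).parts ∩ Q.parts := by
  intro C hC
  rw [mem_inter] at hC ⊢
  refine ⟨(mem_parts_split hij hP).2 (Or.inl ⟨hC.1, ?_⟩), hC.2⟩
  rintro rfl
  rw [Q.part_eq_of_mem hC.2 (self_mem_part P i)] at hQ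
  exact hQ hP

/-- The two new blocks of the split of `Q` separate `i` from `j`, so neither lies in `P`; the common
blocks are old ones avoiding `i`. -/
theorem inter_split_subset_split_inter {i j : Fin n} {P Q : SetPartition n} (hij : i ≠ j)
    (hP : j ∈ P.part i) (hQ : j ∈ Q.part i) :
    P.parts ∩ (split i j Q).parts ⊆ (split i j P).parts ∩ Q.parts := by
  intro C hC
  rw [mem_inter, mem_parts_split hij hQ] at hC
  rw [mem_inter]
  obtain ⟨hCP, h1 | rfl | rfl⟩ := hC
  · refine ⟨(mem_parts_split hij hP).2 (Or.inl ⟨hCP, ?_⟩), h1.1⟩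
    rintro rfl
    exact h1.2 (Q.part_eq_of_mem h1.1 (self_mem_part P i)).symm
  · exact absurd hCP (singleton_notMem_of_mem_part hij hP)
  · have := P.eq_of_mem_parts hCP (part_mem_parts P i) (a := j) (by simp [hQ, hij.symm]) hP
    have h2 := self_mem_part P i
    rw [← this] at h2
    simp at h2

/-- At most one common block, that of `i`, is lost, and the common block `{i}` is gained. -/
theorem card_inter_le_card_split_inter_split {i j : Fin n} {P Q : SetPartition n} (hij : i ≠ j)
    (hP : j ∈ P.part i) (hQ : j ∈ Q.part i) :
    (P.parts ∩ Q.parts).card ≤ ((split i j P).parts ∩ (split i j Q).parts).card := by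
  have h1 : insert {i} ((P.parts ∩ Q.parts).erase (P.part i)) ⊆
      (split i j P).parts ∩ (split i j Q).parts := by
    intro C hC
    rw [mem_insert, mem_erase, mem_inter] at hC
    rw [mem_inter, mem_parts_split hij hP, mem_parts_split hij hQ]
    rcases hC with rfl | ⟨hne, hCP, hCQ⟩
    · exact ⟨Or.inr (Or.inl rfl), Or.inr (Or.inl rfl)⟩
    · refine ⟨Or.inl ⟨hCP, hne⟩, Or.inl ⟨hCQ, ?_⟩⟩
      rintro rfl
      exact hne (P.part_eq_of_mem hCP (self_mem_part Q i)).symm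
  have h2 : {i} ∉ (P.parts ∩ Q.parts).erase (P.part i) := fun h =>
    singleton_notMem_of_mem_part hij hP (mem_inter.1 (mem_erase.1 h).2).1
  have h3 := card_le_card h1
  rw [card_insert_of_notMem h2] at h3
  have h4 := pred_card_le_card_erase (s := P.parts ∩ Q.parts) (a := P.part i)
  omega

/-- The delicate pair is a moved member against a member `Q` that stays. If `Q` joins `i` to `j`,
its split is also in `𝒜`, and the bound is borrowed from that split. -/
theorem IsIntersecting.splitting {t : ℕ} {𝒜 : Finset (SetPartition n)} (h𝒜 : IsIntersecting t 𝒜)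
    {i j : Fin n} (hij : i ≠ j) : IsIntersecting t (splitting i j 𝒜) := by
  have mixed : ∀ P ∈ movable i j 𝒜, ∀ Q ∈ 𝒜, split i j Q ∈ 𝒜 →
      t ≤ ((split i j P).parts ∩ Q.parts).card := by
    intro P hP Q hQ hQs
    have hj := mem_part_of_mem_movable hP
    have hP𝒜 := (mem_movable.1 hP).1
    by_cases hQj : j ∈ Q.part i
    · exact (h𝒜 P hP𝒜 _ hQs).trans (card_le_card (inter_split_subset_split_inter hij hj hQj))
    · exact (h𝒜 P hP𝒜 Q hQ).trans (card_le_card (inter_subset_split_inter hij hj hQj))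
  intro P hP Q hQ
  rcases mem_splitting.1 hP with ⟨hP', hPs⟩ | ⟨P, hP', rfl⟩ <;>
    rcases mem_splitting.1 hQ with ⟨hQ', hQs⟩ | ⟨Q, hQ', rfl⟩
  · exact h𝒜 P hP' Q hQ'
  · rw [inter_comm]
    exact mixed Q hQ' P hP' hPs
  · exact mixed P hP' Q hQ' hQs
  · exact (h𝒜 P (mem_movable.1 hP').1 Q (mem_movable.1 hQ').1).trans
      (card_inter_le_card_split_inter_split hij (mem_part_of_mem_movable hP')
        (mem_part_of_mem_movable hQ'))

/-- The elements of `X` are split off one at a time; this destroys no singleton and separates no two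
elements outside `X`. -/
theorem exists_singletons_of_closed {𝒜 : Finset (SetPartition n)} (X : Finset (Fin n))
    (h𝒜 : ∀ k ∈ X, ∀ l, k ≠ l → ∀ P ∈ 𝒜, split k l P ∈ 𝒜) {P : SetPartition n} (hP : P ∈ 𝒜) :
    ∃ Q ∈ 𝒜, (∀ x ∈ X, {x} ∈ Q.parts) ∧ (∀ x, {x} ∈ P.parts → {x} ∈ Q.parts) ∧
      ∀ x y, x ∉ X → y ∉ X → y ∈ P.part x → y ∈ Q.part x := by
  induction X using Finset.induction_on with
  | empty => exact ⟨P, hP, by simp, fun _ h => h, fun _ _ _ _ h => h⟩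
  | insert k X hk ih =>
    obtain ⟨Q, hQ, h1, h2, h3⟩ := ih fun m hm => h𝒜 m (mem_insert_of_mem hm)
    by_cases hkQ : {k} ∈ Q.parts
    · refine ⟨Q, hQ, ?_, h2, fun x y hx hy => h3 x y ?_ ?_⟩
      · intro x hx
        rcases mem_insert.1 hx with rfl | hx
        exacts [hkQ, h1 x hx]
      · exact fun h => hx (mem_insert_of_mem h)
      · exact fun h => hy (mem_insert_of_mem h)
    · rw [singleton_mem_parts_iff_forall] at hkQ
      push Not at hkQ
      obtain ⟨l, hl, hlk⟩ := hkQ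
      refine ⟨split k l Q, h𝒜 k (mem_insert_self _ _) l hlk.symm Q hQ, ?_,
        fun x hx => singleton_mem_split hlk.symm (h2 x hx), fun x y hx hy hxy => ?_⟩
      · intro x hx
        rcases mem_insert.1 hx with rfl | hx
        exacts [singleton_mem_split_self hlk.symm hl, singleton_mem_split hlk.symm (h1 x hx)]
      · simp only [mem_insert, not_or] at hx hy
        exact (mem_part_split hlk.symm hx.1 hy.1).2 (h3 x y hx.2 hy.2 hxy)

/-! ### Partitions into the fibres of a function -/

open Classical in
/-- The partition into the nonempty fibres of `g`. -/
noncomputable def ofFun {β : Type*} (g : Fin n → β) : SetPartition n :=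
  Finpartition.ofSetoid (Setoid.ker g)

theorem mem_part_ofFun {β : Type*} {g : Fin n → β} {x y : Fin n} :
    y ∈ (ofFun g).part x ↔ g x = g y := by
  classical
  rw [ofFun, Finpartition.mem_part_ofSetoid_iff_rel]
  rfl

/-- The partition with block `B` all of whose other blocks are singletons. -/
noncomputable def oneBlock (B : Finset (Fin n)) : SetPartition n :=
  ofFun fun x => if x ∈ B then none else some x

theorem mem_part_oneBlock {B : Finset (Fin n)} {x y : Fin n} :
    y ∈ (oneBlock B).part x ↔ y = x ∨ (x ∈ B ∧ y ∈ B) := by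
  rw [oneBlock, mem_part_ofFun]
  by_cases hx : x ∈ B <;> by_cases hy : y ∈ B <;> simp [hx, hy, eq_comm]
  · rintro rfl; exact hy hx
  · rintro rfl; exact hx hy

theorem singleton_mem_oneBlock_of_notMem {B : Finset (Fin n)} {x : Fin n} (hx : x ∉ B) :
    {x} ∈ (oneBlock B).parts := by
  simp [singleton_mem_parts_iff_forall, mem_part_oneBlock, hx]

theorem singleton_notMem_oneBlock {B : Finset (Fin n)} {x : Fin n} (hx : x ∈ B) (hB : 2 ≤ B.card) :
    {x} ∉ (oneBlock B).parts := by
  rw [singleton_mem_parts_iff_forall]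
  intro h
  obtain ⟨y, hy, hyx⟩ := exists_mem_ne hB x
  exact hyx (h y (mem_part_oneBlock.2 (Or.inr ⟨hx, hy⟩)))

/-- The partition obtained from `P` by relabelling the ground set along `σ`. -/
noncomputable def relabel (σ : Equiv.Perm (Fin n)) (P : SetPartition n) : SetPartition n :=
  ofFun fun x => P.part (σ x)

theorem mem_part_relabel {σ : Equiv.Perm (Fin n)} {P : SetPartition n} {x y : Fin n} :
    y ∈ (relabel σ P).part x ↔ σ y ∈ P.part (σ x) := by
  rw [relabel, mem_part_ofFun, part_eq_part_iff]

theorem relabel_injective (σ : Equiv.Perm (Fin n)) : Function.Injective (relabel σ) := by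
  intro P Q h
  refine ext_of_part fun x y => ?_
  have := @mem_part_relabel n σ P (σ.symm x) (σ.symm y)
  rw [h, mem_part_relabel] at this
  simpa using this.symm

/-- The partition obtained from `P` by moving `w` to the block `C`. -/
noncomputable def moveTo (w : Fin n) (P : SetPartition n) (C : Finset (Fin n)) : SetPartition n :=
  ofFun fun x => if x = w then C else P.part x

theorem mem_part_moveTo_self {w : Fin n} {P : SetPartition n} {C : Finset (Fin n)}
    (hC : C ∈ P.parts) {x : Fin n} (hx : x ≠ w) : x ∈ (moveTo w P C).part w ↔ x ∈ C := by
  rw [moveTo, mem_part_ofFun, if_pos rfl, if_neg hx, eq_comm, P.part_eq_iff_mem hC]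

theorem mem_part_moveTo {w : Fin n} {P : SetPartition n} {C : Finset (Fin n)}
    {x y : Fin n} (hx : x ≠ w) (hy : y ≠ w) : y ∈ (moveTo w P C).part x ↔ y ∈ P.part x := by
  rw [moveTo, mem_part_ofFun, if_neg hx, if_neg hy, part_eq_part_iff]

theorem moveTo_injective {w : Fin n} {P P' : SetPartition n} {C C' : Finset (Fin n)}
    (hw : {w} ∈ P.parts) (hw' : {w} ∈ P'.parts) (hC : C ∈ P.parts) (hC' : C' ∈ P'.parts)
    (h : moveTo w P C = moveTo w P' C') : P = P' ∧ C = C' := by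
  have hP : P = P' := by
    refine ext_of_part fun x y => ?_
    have e := (singleton_mem_parts_iff _).1 hw
    have e' := (singleton_mem_parts_iff _).1 hw'
    by_cases hx : x = w
    · subst hx
      rw [e, e']
    · by_cases hy : y = w
      · subst hy
        rw [mem_part_comm, e, mem_part_comm, e']
      · rw [← mem_part_moveTo (P := P) (C := C) hx hy, h, mem_part_moveTo hx hy]
  subst hP
  refine ⟨rfl, ?_⟩
  have key : ∀ x, x ≠ w → (x ∈ C ↔ x ∈ C') := fun x hx => by
    rw [← mem_part_moveTo_self hC hx, h, mem_part_moveTo_self hC' hx]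
  obtain ⟨x, hx⟩ := P.nonempty_of_mem_parts hC
  obtain ⟨y, hy⟩ := P.nonempty_of_mem_parts hC'
  -- The blocks are compared off `w`; only `{w}`, which leaves `w` where it was, has no element
  -- there.
  by_cases hxw : x = w
  · by_cases hyw : y = w
    · subst hxw hyw
      exact P.eq_of_mem_parts hC hC' hx hy
    · exact P.eq_of_mem_parts hC hC' ((key y hyw).2 hy) hy
  · exact P.eq_of_mem_parts hC hC' hx ((key x hxw).1 hx)

/-! ### Partitions with prescribed singletons -/

/-- The partitions in which every element of `W` is a singleton block. -/
def fixing (W : Finset (Fin n)) : Finset (SetPartition n) :=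
  univ.filter fun P => ∀ x ∈ W, {x} ∈ P.parts

theorem mem_fixing {W : Finset (Fin n)} {P : SetPartition n} :
    P ∈ fixing W ↔ ∀ x ∈ W, {x} ∈ P.parts := by
  simp [fixing]

theorem fixing_inter_fixing (V W : Finset (Fin n)) : fixing V ∩ fixing W = fixing (V ∪ W) := by
  ext P
  simp only [mem_inter, mem_fixing, mem_union]
  exact ⟨fun h x hx => hx.elim (h.1 x) (h.2 x),
    fun h => ⟨fun x hx => h x (Or.inl hx), fun x hx => h x (Or.inr hx)⟩⟩

theorem fixing_anti {V W : Finset (Fin n)} (h : V ⊆ W) : fixing W ⊆ fixing V := fun _ hP =>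
  mem_fixing.2 fun x hx => mem_fixing.1 hP x (h hx)

theorem card_fixing_le_of_perm {V W : Finset (Fin n)} (σ : Equiv.Perm (Fin n))
    (h : ∀ x ∈ W, σ x ∈ V) : (fixing V).card ≤ (fixing W).card := by
  refine card_le_card_of_injOn (relabel σ) (fun P hP => ?_) (relabel_injective σ).injOn
  simp only [mem_coe, mem_fixing, singleton_mem_parts_iff_forall, mem_part_relabel] at hP ⊢
  exact fun x hx y hy => σ.injective (hP _ (h x hx) _ hy)

theorem card_fixing_eq {V W : Finset (Fin n)} (h : V.card = W.card) :
    (fixing V).card = (fixing W).card := by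
  have key : ∀ {V W : Finset (Fin n)}, V.card = W.card → (fixing V).card ≤ (fixing W).card := by
    intro V W h
    exact card_fixing_le_of_perm (Finset.equivOfCardEq h.symm).extendSubtype
      fun x hx => Equiv.extendSubtype_mem _ x hx
  exact le_antisymm (key h) (key h.symm)

theorem card_fixing_le_of_card_le {V W : Finset (Fin n)} (h : W.card ≤ V.card) :
    (fixing V).card ≤ (fixing W).card := by
  obtain ⟨V', hV', hc⟩ := exists_subset_card_eq h
  exact (card_le_card (fixing_anti hV')).trans (card_fixing_eq hc).le

/-- The blocks of `P` that are not singletons of elements of `W`. -/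
def freeParts (W : Finset (Fin n)) (P : SetPartition n) : Finset (Finset (Fin n)) :=
  P.parts \ W.image fun x => {x}

/-- Moving `w` into any free block, including its own block `{w}`, keeps the singletons `W`, and
different choices give different partitions. -/
theorem sum_card_freeParts_le {W : Finset (Fin n)} {w : Fin n} (hw : w ∉ W) :
    ∑ P ∈ fixing (insert w W), (freeParts W P).card ≤ (fixing W).card := by
  rw [← card_sigma]
  refine card_le_card_of_injOn (fun p => moveTo w p.1 p.2) ?_ ?_
  · rintro ⟨P, C⟩ h
    simp only [coe_sigma, Set.mem_sigma_iff, mem_coe, freeParts, mem_sdiff, mem_image,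
      not_exists, not_and, mem_fixing] at h ⊢
    obtain ⟨hP, hC, hCW⟩ := h
    intro x hx
    have hxw : x ≠ w := fun e => hw (e ▸ hx)
    have hxP := hP x (mem_insert_of_mem hx)
    rw [singleton_mem_parts_iff_forall]
    intro y hy
    by_cases hyw : y = w
    · subst hyw
      rw [mem_part_comm, mem_part_moveTo_self hC hxw] at hy
      exact absurd (P.eq_of_mem_parts hxP hC (mem_singleton_self x) hy) (hCW x hx)
    · rw [mem_part_moveTo hxw hyw] at hy
      exact (singleton_mem_parts_iff_forall _).1 hxP y hy
  · rintro ⟨P, C⟩ h ⟨P', C'⟩ h' e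
    simp only [coe_sigma, Set.mem_sigma_iff, mem_coe, freeParts, mem_sdiff, mem_fixing] at h h'
    obtain ⟨rfl, rfl⟩ := moveTo_injective (h.1 w (mem_insert_self _ _))
      (h'.1 w (mem_insert_self _ _)) h.2.1 h'.2.1 e
    rfl

/-- Besides `{w}` there are two free blocks, unless all remaining elements share one block. -/
theorem three_le_card_freeParts {W : Finset (Fin n)} {w : Fin n} (hw : w ∉ W)
    {P : SetPartition n} (hP : P ∈ fixing (insert w W))
    (hne : P ≠ oneBlock (insert w W)ᶜ) : 3 ≤ (freeParts W P).card := by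
  rw [mem_fixing] at hP
  have free : ∀ x, x ∉ W → P.part x ∈ freeParts W P := by
    intro x hx
    simp only [freeParts, mem_sdiff, mem_image, not_exists, not_and]
    refine ⟨part_mem_parts P x, fun y hy e => hx ?_⟩
    have := self_mem_part P x
    rw [← e, mem_singleton] at this
    exact this ▸ hy
  have hpw : ∀ x, x ∉ insert w W → P.part w ≠ P.part x := by
    intro x hx e
    rw [part_eq_part_iff, (singleton_mem_parts_iff _).1 (hP w (mem_insert_self _ _)),
      mem_singleton] at e
    exact hx (e ▸ mem_insert_self _ _)
  obtain ⟨x, y, hx, hy, hxy⟩ : ∃ x y, x ∉ insert w W ∧ y ∉ insert w W ∧ P.part x ≠ P.part y := by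
    by_contra! hcon
    refine hne (ext_of_part fun x y => ?_)
    rw [mem_part_oneBlock, mem_compl, mem_compl]
    by_cases hx : x ∈ insert w W
    · simp [(singleton_mem_parts_iff _).1 (hP x hx), hx]
    · by_cases hy : y ∈ insert w W
      · rw [mem_part_comm, (singleton_mem_parts_iff _).1 (hP y hy), mem_singleton]
        simp [hy, eq_comm]
      · simp only [hx, hy, not_false_eq_true, and_self, or_true, iff_true]
        exact (part_eq_part_iff P).1 (hcon x y hx hy)
  have hxW : x ∉ W := fun h => hx (mem_insert_of_mem h)
  have hyW : y ∉ W := fun h => hy (mem_insert_of_mem h)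
  exact two_lt_card.2 ⟨_, free w hw, _, free x hxW, _, free y hyW, hpw x hx, hpw y hy, hxy⟩

theorem card_freeParts_bot (W : Finset (Fin n)) : n - W.card ≤ (freeParts W ⊥).card := by
  have h1 : (⊥ : SetPartition n).parts.card = n := by simp
  have h2 := le_card_sdiff (W.image fun x => {x}) (⊥ : SetPartition n).parts
  have h3 : (W.image fun x => ({x} : Finset (Fin n))).card ≤ W.card := card_image_le
  rw [freeParts]
  omega

theorem three_mul_card_fixing_insert_lt {W : Finset (Fin n)} {w : Fin n} (hw : w ∉ W)
    (hn : W.card + 7 ≤ n) : 3 * (fixing (insert w W)).card < (fixing W).card := by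
  -- The exceptional one-block partition costs at most 3, while `⊥` has at least 7 free blocks, a
  -- surplus of 4; the net gain of 1 makes the inequality strict.
  have h1 : ∑ P ∈ fixing (insert w W), (3 + if P = ⊥ then 4 else 0) ≤
      ∑ P ∈ fixing (insert w W),
        ((freeParts W P).card + if P = oneBlock (insert w W)ᶜ then 3 else 0) := by
    refine sum_le_sum fun P hP => ?_
    by_cases hb : P = ⊥
    · subst hb
      have := card_freeParts_bot W
      simp only [if_true]
      omega
    · by_cases ho : P = oneBlock (insert w W)ᶜ
      · rw [if_neg hb, if_pos ho]
        omega
      · have := three_le_card_freeParts hw hP ho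
        rw [if_neg hb]
        omega
  have hbot : (⊥ : SetPartition n) ∈ fixing (insert w W) :=
    mem_fixing.2 fun x _ => eq_bot_iff_singletons.1 rfl x
  rw [sum_add_distrib, sum_add_distrib, sum_ite_eq', sum_ite_eq', if_pos hbot, sum_const,
    smul_eq_mul] at h1
  have h2 := sum_card_freeParts_le hw
  have h3 : (if oneBlock (insert w W)ᶜ ∈ fixing (insert w W) then 3 else 0) ≤ 3 := by
    split_ifs <;> simp
  omega

/-! ### A large non-trivial intersecting family -/

theorem card_le_card_inter_of_singletons {P Q : SetPartition n} {V : Finset (Fin n)}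
    (hP : P ∈ fixing V) (hQ : Q ∈ fixing V) : V.card ≤ (P.parts ∩ Q.parts).card := by
  rw [← card_map ⟨fun x : Fin n => ({x} : Finset (Fin n)), singleton_injective⟩]
  refine card_le_card fun C hC => ?_
  obtain ⟨x, hx, rfl⟩ := mem_map.1 hC
  exact mem_inter.2 ⟨mem_fixing.1 hP x hx, mem_fixing.1 hQ x hx⟩

/-- There are non-trivial `t`-intersecting families with more than twice as many members as there
are partitions with `t + 1` prescribed singletons. -/
theorem exists_large_nontrivialIntersecting {t : ℕ} (ht : 1 ≤ t) (hn : t + 10 ≤ n) :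
    ∃ ℬ : Finset (SetPartition n), IsNontrivialIntersecting t ℬ ∧
      ∀ W : Finset (Fin n), t + 1 ≤ W.card → 2 * (fixing W).card < ℬ.card := by
  obtain ⟨T, -, hT⟩ := exists_subset_card_eq (s := (univ : Finset (Fin n))) (n := t)
    (by simp; omega)
  obtain ⟨U, hUT, hU⟩ := exists_subset_card_eq (s := Tᶜ) (n := 3) (by simp [card_compl]; omega)
  obtain ⟨a, b, c, hab, hac, hbc, rfl⟩ := card_eq_three.1 hU
  obtain ⟨z, -, hz⟩ := exists_mem_notMem_of_card_lt_card
    (s := T ∪ {a, b, c}) (t := (univ : Finset (Fin n))) (by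
      have := card_union_le T {a, b, c}
      rw [card_univ, Fintype.card_fin]
      omega)
  obtain ⟨s, hs⟩ : T.Nonempty := card_pos.1 (by omega)
  simp only [insert_subset_iff, singleton_subset_iff, mem_compl] at hUT
  obtain ⟨haT, hbT, hcT⟩ := hUT
  simp only [mem_union, mem_insert, mem_singleton, not_or] at hz
  obtain ⟨hzT, hza, hzb, hzc⟩ := hz
  have hsz : s ≠ z := fun e => hzT (e ▸ hs)
  -- `Q` breaks triviality by lacking `{s}` with `s ∈ T`. Since `z` avoids `T` and `a, b, c`, the
  -- remaining `t` singletons of each `insert d T` survive in `Q`.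
  set Q : SetPartition n := oneBlock {s, z} with hQ
  have hQs : {s} ∉ Q.parts := singleton_notMem_oneBlock (by simp) (by rw [card_pair hsz])
  have hQx : ∀ x, x ≠ s → x ≠ z → {x} ∈ Q.parts := fun x h1 h2 =>
    singleton_mem_oneBlock_of_notMem (by simp [h1, h2])
  set 𝒢 := fixing (insert a T) ∪ fixing (insert b T) ∪ fixing (insert c T) with h𝒢
  have hTsub : ∀ P ∈ 𝒢, P ∈ fixing T := by
    intro P hP
    simp only [h𝒢, mem_union] at hP
    rcases hP with (h | h) | h <;> exact fixing_anti (subset_insert _ _) h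
  have hQin : ∀ P ∈ 𝒢, t ≤ (P.parts ∩ Q.parts).card := by
    intro P hP
    have key : ∀ d, d ∉ T → d ≠ z → P ∈ fixing (insert d T) → t ≤ (P.parts ∩ Q.parts).card := by
      intro d hd hdz hPd
      have hds : d ≠ s := fun e => hd (e ▸ hs)
      have hc : ((insert d T).erase s).card = t := by
        rw [card_erase_of_mem (mem_insert_of_mem hs), card_insert_of_notMem hd]
        omega
      rw [← hc]
      refine card_le_card_inter_of_singletons (fixing_anti (erase_subset _ _) hPd)
        (mem_fixing.2 fun x hx => ?_)
      rw [mem_erase, mem_insert] at hx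
      refine hQx x hx.1 ?_
      rintro rfl
      exact hx.2.elim (fun e => hdz e.symm) hzT
    simp only [h𝒢, mem_union] at hP
    rcases hP with (h | h) | h
    exacts [key a haT (Ne.symm hza) h, key b hbT (Ne.symm hzb) h, key c hcT (Ne.symm hzc) h]
  refine ⟨insert Q 𝒢, ⟨?_, ?_⟩, ?_⟩
  · intro P hP R hR
    rcases mem_insert.1 hP with rfl | hP' <;> rcases mem_insert.1 hR with rfl | hR'
    · have hc : t ≤ (({s, z} : Finset (Fin n))ᶜ).card := by
        rw [card_compl, card_pair hsz, Fintype.card_fin]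
        omega
      have hQf : Q ∈ fixing ({s, z} : Finset (Fin n))ᶜ := mem_fixing.2 fun x hx =>
        singleton_mem_oneBlock_of_notMem (mem_compl.1 hx)
      exact hc.trans (card_le_card_inter_of_singletons hQf hQf)
    · rw [inter_comm]
      exact hQin R hR'
    · exact hQin P hP'
    · exact hT ▸ card_le_card_inter_of_singletons (hTsub P hP') (hTsub R hR')
  · rintro ⟨T', hT', hfix⟩
    -- These partitions have no singletons beyond `insert d T`. Taking `d = a` and `d = b` forces
    -- `T' = T`, which `Q` excludes.
    have key : ∀ d, d ∉ T → oneBlock (insert d T)ᶜ ∈ insert Q 𝒢 → T' ⊆ insert d T := by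
      intro d hd hmem x hx
      by_contra hxd
      refine singleton_notMem_oneBlock (mem_compl.2 hxd) ?_ (hfix _ hmem x hx)
      rw [card_compl, card_insert_of_notMem hd, Fintype.card_fin]
      omega
    have hblock : ∀ d, oneBlock (insert d T)ᶜ ∈ fixing (insert d T) := fun d =>
      mem_fixing.2 fun x hx => singleton_mem_oneBlock_of_notMem (notMem_compl.2 hx)
    have ha := key a haT (mem_insert_of_mem (mem_union_left _ (mem_union_left _ (hblock a))))
    have hb := key b hbT (mem_insert_of_mem (mem_union_left _ (mem_union_right _ (hblock b))))
    have hsub : T' ⊆ T := by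
      intro x hx
      rcases mem_insert.1 (ha hx) with rfl | h
      · exact (mem_insert.1 (hb hx)).resolve_left hab
      · exact h
    have hTT : T' = T := eq_of_subset_of_card_le hsub (by omega)
    exact hQs (hfix Q (mem_insert_self _ _) s (hTT ▸ hs))
  · intro W hW
    have hca : (insert a T).card = t + 1 := by rw [card_insert_of_notMem haT, hT]
    have hcb : (insert b T).card = t + 1 := by rw [card_insert_of_notMem hbT, hT]
    have hcc : (insert c T).card = t + 1 := by rw [card_insert_of_notMem hcT, hT]
    have hb' : b ∉ insert a T := by simp [hab.symm, hbT]
    have hlt := three_mul_card_fixing_insert_lt hb' (by omega)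
    have pair : ∀ d e, d ∉ T → e ∉ T → d ≠ e → (fixing (insert d T) ∩ fixing (insert e T)).card =
        (fixing (insert b (insert a T))).card := by
      intro d e hd he hde
      rw [fixing_inter_fixing]
      apply card_fixing_eq
      have : insert d T ∪ insert e T = insert d (insert e T) := by
        ext x
        simp only [mem_union, mem_insert]
        tauto
      rw [this, card_insert_of_notMem (by simp [hde, hd]), card_insert_of_notMem he,
        card_insert_of_notMem hb', card_insert_of_notMem haT]
    -- If `G` counts partitions with `t + 2` prescribed singletons, inclusion–exclusion gives at
    -- least `3F - 3G`, which exceeds `2F` because `3G < F`.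
    have h1 := card_union_add_card_inter (fixing (insert a T)) (fixing (insert b T))
    have h2 := card_union_add_card_inter (fixing (insert a T) ∪ fixing (insert b T))
      (fixing (insert c T))
    have h3 : ((fixing (insert a T) ∪ fixing (insert b T)) ∩ fixing (insert c T)).card ≤
        2 * (fixing (insert b (insert a T))).card := by
      rw [union_inter_distrib_right, two_mul]
      refine (card_union_le _ _).trans ?_
      rw [pair a c haT hcT hac, pair b c hbT hcT hbc]
    rw [pair a b haT hbT hab] at h1
    have h4 := card_fixing_eq (hcb.trans hca.symm)
    have h5 := card_fixing_eq (hcc.trans hca.symm)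
    have h6 := card_fixing_le_of_card_le (V := W) (W := insert a T) (by omega)
    have h7 : 𝒢.card ≤ (insert Q 𝒢).card := card_le_card (subset_insert _ _)
    rw [← h𝒢] at h2
    omega

/-! ### Upper bounds for families with restricted splittings -/

theorem card_le_card_fixing_of_split {i j : Fin n} (hij : i ≠ j) {W : Finset (Fin n)}
    {ℬ : Finset (SetPartition n)} (hb : ∀ P ∈ ℬ, j ∈ P.part i)
    (hW : ∀ P ∈ ℬ, split i j P ∈ fixing W) : ℬ.card ≤ (fixing W).card :=
  card_le_card_of_injOn (split i j) hW ((split_injOn hij).mono hb)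

theorem split_mem_fixing {i j : Fin n} (hij : i ≠ j) {W : Finset (Fin n)} {P : SetPartition n}
    (hP : P ∈ fixing W) : split i j P ∈ fixing W :=
  mem_fixing.2 fun x hx => singleton_mem_split hij (mem_fixing.1 hP x hx)

/-- A property preserved by a split is preserved by the splitting of a family. -/
theorem forall_splitting {p : SetPartition n → Prop} {𝒜 : Finset (SetPartition n)} {k l : Fin n}
    (hp : ∀ P, p P → p (split k l P)) (h : ∀ P ∈ 𝒜, p P) : ∀ P ∈ splitting k l 𝒜, p P := by
  intro P hP
  rcases mem_splitting.1 hP with ⟨hP, -⟩ | ⟨Q, hQ, rfl⟩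
  exacts [h P hP, hp Q (h Q (mem_movable.1 hQ).1)]

/-- Let `R` be a member of a family closed under splitting off elements of `X`. If all common
blocks of `R` and `Q` outside `𝒦` meet `X` and have further elements, they can be removed. -/
theorem exists_inter_subset_of_closed {𝒜 : Finset (SetPartition n)} {X : Finset (Fin n)}
    (h𝒜 : ∀ k ∈ X, ∀ l, k ≠ l → ∀ P ∈ 𝒜, split k l P ∈ 𝒜) {Q : SetPartition n}
    {𝒦 : Finset (Finset (Fin n))}
    (hQ : ∀ C ∈ Q.parts, C ∉ 𝒦 → (∃ k ∈ C, k ∈ X) ∧ 2 ≤ C.card)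
    {R : SetPartition n} (hR : R ∈ 𝒜) :
    ∃ R' ∈ 𝒜, R'.parts ∩ Q.parts ⊆ 𝒦 ∩ R.parts := by
  induction hm : (R.parts ∩ Q.parts).card using Nat.strong_induction_on generalizing R with
  | _ m ih =>
  subst hm
  by_cases hsub : R.parts ∩ Q.parts ⊆ 𝒦
  · exact ⟨R, hR, fun C hC => mem_inter.2 ⟨hsub hC, (mem_inter.1 hC).1⟩⟩
  · obtain ⟨C, hC, hCK⟩ := not_subset.1 hsub
    rw [mem_inter] at hC
    obtain ⟨⟨k, hkC, hkX⟩, hC2⟩ := hQ C hC.2 hCK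
    obtain ⟨l, hlC, hlk⟩ := exists_mem_ne hC2 k
    have hl : l ∈ R.part k := by rwa [R.part_eq_of_mem hC.1 hkC]
    -- Neither `{k}` nor `C \ {k}` can be a block of `Q`, since both are nonempty proper subsets of
    -- its block `C`; so `C` is lost and nothing new is shared.
    have hnew : ∀ D ∈ (split k l R).parts ∩ Q.parts, D ∈ R.parts ∧ D ≠ C := by
      intro D hD
      rw [mem_inter, mem_parts_split hlk.symm hl, R.part_eq_of_mem hC.1 hkC] at hD
      obtain ⟨h | rfl | rfl, hDQ⟩ := hD
      · exact h
      · have := Q.eq_of_mem_parts hDQ hC.2 (mem_singleton_self k) hkC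
        rw [← this, mem_singleton] at hlC
        exact absurd hlC hlk
      · have := Q.eq_of_mem_parts hDQ hC.2 (a := l) (by simp [hlC, hlk]) hlC
        rw [← this] at hkC
        simp at hkC
    have hss : (split k l R).parts ∩ Q.parts ⊂ R.parts ∩ Q.parts := by
      refine (ssubset_iff_of_subset fun D hD => ?_).2 ⟨C, mem_inter.2 hC, fun h => (hnew C h).2 rfl⟩
      exact mem_inter.2 ⟨(hnew D hD).1, (mem_inter.1 hD).2⟩
    obtain ⟨R', hR', hs⟩ := ih _ (card_lt_card hss) (h𝒜 k hkX l hlk.symm R hR) rfl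
    refine ⟨R', hR', fun D hD => mem_inter.2 ⟨(mem_inter.1 (hs hD)).1, ?_⟩⟩
    exact (hnew D (mem_inter.2 ⟨(mem_inter.1 (hs hD)).2, (mem_inter.1 hD).2⟩)).1

/-- A family `𝒜`, each member of which either has the singletons `T` or has `i, j` in one block,
is small if a splitting that keeps `i, j` together makes it trivial. -/
theorem card_le_of_isTrivial_splitting {t : ℕ} {𝒜 : Finset (SetPartition n)} {i j k l : Fin n}
    (hij : i ≠ j) (hkl : k ≠ l) (hki : k ≠ i) (hkj : k ≠ j) {T : Finset (Fin n)}
    (hTij : i ∈ T ∨ j ∈ T)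
    (h𝒜 : ∀ P ∈ 𝒜, P ∈ fixing T ∨ j ∈ P.part i) (hne : ∃ P ∈ 𝒜, j ∈ P.part i)
    (htriv : IsTrivial t (splitting k l 𝒜)) :
    ∃ V W : Finset (Fin n), t + 1 ≤ V.card ∧ t + 1 ≤ W.card ∧
      𝒜.card ≤ (fixing V).card + (fixing W).card := by
  obtain ⟨T', hT', hfix⟩ := htriv
  have hS : ∀ P ∈ splitting k l 𝒜, P ∈ fixing T ∨ j ∈ P.part i :=
    forall_splitting (fun P hP => hP.imp (split_mem_fixing hkl)
      (mem_part_split hkl hki.symm hkj.symm).2) h𝒜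
  obtain ⟨P, hP, hPij⟩ : ∃ P ∈ splitting k l 𝒜, j ∈ P.part i := by
    obtain ⟨P, hP, hPij⟩ := hne
    by_cases hs : split k l P ∈ 𝒜
    · exact ⟨P, mem_splitting.2 (Or.inl ⟨hP, hs⟩), hPij⟩
    · exact ⟨_, mem_splitting.2 (Or.inr ⟨P, mem_movable.2 ⟨hP, hs⟩, rfl⟩),
        (mem_part_split hkl hki.symm hkj.symm).2 hPij⟩
  have hi : i ∉ T' := fun h => singleton_notMem_of_mem_part hij hPij (hfix P hP i h)
  have hj : j ∉ T' := fun h =>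
    singleton_notMem_of_mem_part hij.symm (mem_part_comm.1 hPij) (hfix P hP j h)
  -- After the splitting, members with the singletons `T` also have `T'`, and `T` adds `i` or `j`.
  -- The others join `i` to `j`, so splitting off `i` adds `{i}` to `T'`.
  refine ⟨T ∪ T', insert i T', ?_, by rw [card_insert_of_notMem hi, hT'], ?_⟩
  · have hss : T' ⊂ T ∪ T' := by
      refine (ssubset_iff_of_subset subset_union_right).2 ?_
      rcases hTij with h | h
      exacts [⟨i, mem_union_left _ h, hi⟩, ⟨j, mem_union_left _ h, hj⟩]
    have := card_lt_card hss
    omega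
  · rw [← card_splitting hkl 𝒜, ← card_filter_add_card_filter_not (fun P => P ∈ fixing T)]
    refine Nat.add_le_add (card_le_card fun P hP => ?_)
      (card_le_card_fixing_of_split hij (fun P hP => ?_) fun P hP => mem_fixing.2 fun x hx => ?_)
    · rw [mem_filter] at hP
      rw [← fixing_inter_fixing, mem_inter]
      exact ⟨hP.2, mem_fixing.2 (hfix P hP.1)⟩
    · rw [mem_filter] at hP
      exact (hS P hP.1).resolve_left hP.2
    · rw [mem_filter] at hP
      have hPij := (hS P hP.1).resolve_left hP.2
      rcases mem_insert.1 hx with rfl | hx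
      · exact singleton_mem_split_self hij hPij
      · exact singleton_mem_split hij (hfix P hP.1 x hx)

/-- A family of partitions joining `i` to `j` with singletons off `X ∪ {i, j}` that is closed under
splitting off elements of `X` is small unless it remains `t`-intersecting with `⊥`. -/
theorem card_le_of_closed_of_joined {t : ℕ} {𝒜 : Finset (SetPartition n)} {i j : Fin n}
    (hij : i ≠ j) (hint : IsIntersecting t 𝒜) {X : Finset (Fin n)}
    (hcl : ∀ k ∈ X, ∀ l, k ≠ l → ∀ P ∈ 𝒜, split k l P ∈ 𝒜)
    (hjoin : ∀ P ∈ 𝒜, j ∈ P.part i)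
    (hX : ∀ P ∈ 𝒜, ∀ x, x ∉ X → x ≠ i → x ≠ j → {x} ∈ P.parts)
    {Q₀ : SetPartition n} (hQ₀ : Q₀ ∈ 𝒜) (hsing : ∀ x, x ≠ i → x ≠ j → {x} ∈ Q₀.parts)
    {Q : SetPartition n} (hQ : Q ∈ 𝒜) (hlt : (Q.parts ∩ (⊥ : SetPartition n).parts).card < t) :
    ∃ V : Finset (Fin n), t + 1 ≤ V.card ∧ 𝒜.card ≤ (fixing V).card := by
  have hQ₀parts : ∀ C ∈ Q₀.parts, C = {i, j} ∨ C ∈ (⊥ : SetPartition n).parts := by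
    intro C hC
    by_cases h : ∃ x ∈ C, x ≠ i ∧ x ≠ j
    · obtain ⟨x, hx, hxi, hxj⟩ := h
      right
      rw [Q₀.eq_of_mem_parts hC (hsing x hxi hxj) hx (mem_singleton_self x)]
      exact eq_bot_iff_singletons.1 rfl x
    · left
      push Not at h
      have hiC : i ∈ C := by
        obtain ⟨x, hx⟩ := Q₀.nonempty_of_mem_parts hC
        by_cases hxi : x = i
        · exact hxi ▸ hx
        · have hxj := h x hx hxi
          subst hxj
          rw [← Q₀.part_eq_of_mem hC hx]
          exact mem_part_comm.1 (hjoin Q₀ hQ₀)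
      have hjC : j ∈ C := by
        rw [← Q₀.part_eq_of_mem hC hiC]
        exact hjoin Q₀ hQ₀
      ext x
      rw [mem_insert, mem_singleton]
      refine ⟨fun hx => or_iff_not_imp_left.2 (h x hx), ?_⟩
      rintro (rfl | rfl) <;> assumption
  have hsub : Q.parts ∩ Q₀.parts ⊆ insert {i, j} (Q.parts ∩ (⊥ : SetPartition n).parts) := by
    intro C hC
    rw [mem_inter] at hC
    exact mem_insert.2 ((hQ₀parts C hC.2).imp_right fun h => mem_inter.2 ⟨hC.1, h⟩)
  have hge := hint Q hQ Q₀ hQ₀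
  have hle := (card_le_card hsub).trans (card_insert_le _ _)
  -- Otherwise `Q` and `Q₀` would share only singletons of `Q`, fewer than `t`. Hence `Q` and `Q₀`
  -- share exactly `t` blocks.
  have hmem : {i, j} ∈ Q.parts ∩ Q₀.parts := by
    by_contra hn
    have := card_le_card ((subset_insert_iff_of_notMem hn).1 hsub)
    omega
  have hQij : Q.part i = {i, j} := Q.part_eq_of_mem (mem_inter.1 hmem).1 (by simp)
  have hcond : ∀ C ∈ Q.parts, C ∉ Q.parts ∩ Q₀.parts → (∃ k ∈ C, k ∈ X) ∧ 2 ≤ C.card := by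
    intro C hC hCn
    have hCQ : C ∉ Q₀.parts := fun h => hCn (mem_inter.2 ⟨hC, h⟩)
    have hnot : ∀ x ∈ C, x ≠ i ∧ x ≠ j := by
      intro x hx
      rw [← not_or]
      intro h
      have := Q.eq_of_mem_parts hC (mem_inter.1 hmem).1 hx (by simpa using h)
      exact hCn (this ▸ hmem)
    have hns : ∀ x ∈ C, C ≠ {x} := by
      rintro x hx rfl
      exact hCQ (hsing x (hnot x hx).1 (hnot x hx).2)
    obtain ⟨x, hx⟩ := Q.nonempty_of_mem_parts hC
    refine ⟨⟨x, hx, ?_⟩, ?_⟩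
    · by_contra hxX
      have := hX Q hQ x hxX (hnot x hx).1 (hnot x hx).2
      exact hns x hx (Q.eq_of_mem_parts hC this hx (mem_singleton_self x))
    · by_contra hcard
      have h1 : C.card = 1 := by
        have := card_pos.2 ⟨x, hx⟩
        omega
      obtain ⟨y, rfl⟩ := card_eq_one.1 h1
      exact hns y (mem_singleton_self y) rfl
  -- Any `R` can be split until it shares with `Q` only blocks from this set of size `t` that `R`
  -- already had; being `t`-intersecting then forces all of them into `R`.
  have hall : ∀ R ∈ 𝒜, Q.parts ∩ Q₀.parts ⊆ R.parts := by
    intro R hR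
    obtain ⟨R', hR', hs⟩ := exists_inter_subset_of_closed hcl hcond hR
    have h1 := (hint R' hR' Q hQ).trans (card_le_card hs)
    exact inter_eq_left.1 (eq_of_subset_of_card_le inter_subset_left (by omega))
  set V : Finset (Fin n) := univ.filter fun x => {x} ∈ Q.parts with hV
  have hcard : Q.parts ∩ (⊥ : SetPartition n).parts = V.image fun x => {x} := by
    ext C
    rw [mem_inter, Finpartition.mem_bot_iff, mem_image]
    constructor
    · rintro ⟨hC, x, -, rfl⟩
      exact ⟨x, by simp [hV, hC], rfl⟩
    · rintro ⟨x, hx, rfl⟩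
      exact ⟨by simpa [hV] using hx, x, mem_univ x, rfl⟩
  rw [hcard, card_image_of_injective _ singleton_injective] at hle
  have hVi : i ∉ V := fun h =>
    singleton_notMem_of_mem_part hij (hjoin Q hQ) (mem_filter.1 h).2
  have hVj : j ∉ V := fun h =>
    singleton_notMem_of_mem_part hij.symm (mem_part_comm.1 (hjoin Q hQ)) (mem_filter.1 h).2
  -- Every member contains `{i, j}` and the singletons of `Q`, of which there are at least `t - 1`;
  -- splitting `{i, j}` yields two more.
  refine ⟨insert i (insert j V), ?_, card_le_card_fixing_of_split hij hjoin fun R hR => ?_⟩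
  · rw [card_insert_of_notMem (by simp [hij, hVi]), card_insert_of_notMem hVj]
    omega
  · have hRij : R.part i = {i, j} := R.part_eq_of_mem (hall R hR hmem) (by simp)
    refine mem_fixing.2 fun x hx => ?_
    rcases mem_insert.1 hx with rfl | hx
    · exact singleton_mem_split_self hij (hjoin R hR)
    rcases mem_insert.1 hx with rfl | hx
    · refine (mem_parts_split hij (hjoin R hR)).2 (Or.inr (Or.inr ?_))
      rw [hRij]
      ext y
      simp only [mem_singleton, mem_sdiff, mem_insert]
      constructor
      · rintro rfl
        exact ⟨Or.inr rfl, hij.symm⟩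
      · exact fun h => h.1.resolve_left h.2
    · have hxi : x ≠ i := fun e => hVi (e ▸ hx)
      have hxj : x ≠ j := fun e => hVj (e ▸ hx)
      exact singleton_mem_split hij
        (hall R hR (mem_inter.2 ⟨(mem_filter.1 hx).2, hsing x hxi hxj⟩))

end SetPartition

/-! ### The main theorem -/

open Finset SetPartition in
theorem theorem3p6 (t : ℕ) (ht : 1 ≤ t) :
    ∃ n₀ : ℕ, ∀ n : ℕ, n₀ ≤ n → ∀ 𝒜 : Finset (SetPartition n),
      SetPartition.IsMaxNontrivialIntersecting t 𝒜 →
      ¬ SetPartition.IsCompressed 𝒜 →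
      ∃ k l : Fin n, k ≠ l ∧ SetPartition.splitting k l 𝒜 ≠ 𝒜 ∧
        SetPartition.IsNontrivialIntersecting t (SetPartition.splitting k l 𝒜) := by
  refine ⟨t + 10, fun n hn 𝒜 ⟨⟨hint, hnt⟩, hmax⟩ hcomp => ?_⟩
  by_contra! hcon
  have htriv : ∀ k l : Fin n, k ≠ l → splitting k l 𝒜 ≠ 𝒜 → IsTrivial t (splitting k l 𝒜) := by
    intro k l hkl hne
    by_contra h
    exact hcon k l hkl hne ⟨hint.splitting hkl, h⟩
  obtain ⟨ℬ, hℬ, hlarge⟩ := exists_large_nontrivialIntersecting ht hn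
  have hbig := hmax ℬ hℬ
  simp only [IsCompressed, not_forall] at hcomp
  obtain ⟨i, j, hij, hne⟩ := hcomp
  obtain ⟨T, hT, hfix⟩ := htriv i j hij hne
  obtain ⟨P₀, hP₀⟩ := exists_mem_movable_of_splitting_ne hne
  have hmov : ∀ P ∈ movable i j 𝒜, split i j P ∈ fixing T := fun P hP =>
    mem_fixing.2 (hfix _ (mem_splitting.2 (Or.inr ⟨P, hP, rfl⟩)))
  have hstay : ∀ P ∈ 𝒜, P ∉ movable i j 𝒜 → P ∈ fixing T := fun P hP hPm => by
    rw [mem_movable, not_and_not_right] at hPm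
    exact mem_fixing.2 (hfix _ (mem_splitting.2 (Or.inl ⟨hP, hPm hP⟩)))
  have hTsing : ∀ P ∈ 𝒜, ∀ x ∈ T, x ≠ i → x ≠ j → {x} ∈ P.parts := by
    intro P hP x hx hxi hxj
    by_cases hPm : P ∈ movable i j 𝒜
    · exact singleton_mem_of_split hij hxi hxj (mem_fixing.1 (hmov P hPm) x hx)
    · exact mem_fixing.1 (hstay P hP hPm) x hx
  have hTij : i ∈ T ∨ j ∈ T := by
    by_contra! h
    refine hnt ⟨T, hT, fun P hP x hx => hTsing P hP x hx ?_ ?_⟩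
    · rintro rfl
      exact h.1 hx
    · rintro rfl
      exact h.2 hx
  set X : Finset (Fin n) := (insert i (insert j T))ᶜ with hX
  have hmemX : ∀ x, x ∈ X ↔ x ≠ i ∧ x ≠ j ∧ x ∉ T := by simp [hX]
  have hcl : ∀ k ∈ X, ∀ l, k ≠ l → ∀ P ∈ 𝒜, split k l P ∈ 𝒜 := by
    intro k hk l hkl P hP
    refine split_mem_of_splitting_eq ?_ hP
    by_contra hne'
    rw [hmemX] at hk
    obtain ⟨V, W, hV, hW, hle⟩ := card_le_of_isTrivial_splitting hij hkl hk.1 hk.2.1 hTij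
      (fun P hP => (em (P ∈ movable i j 𝒜)).symm.imp (hstay P hP) mem_part_of_mem_movable)
      ⟨P₀, (mem_movable.1 hP₀).1, mem_part_of_mem_movable hP₀⟩ (htriv k l hkl hne')
    have h1 := hlarge V hV
    have h2 := hlarge W hW
    omega
  have hsingX : ∀ {Q : SetPartition n}, Q ∈ 𝒜 → (∀ x ∈ X, {x} ∈ Q.parts) →
      ∀ x, x ≠ i → x ≠ j → {x} ∈ Q.parts := by
    intro Q hQ hQX x hxi hxj
    by_cases hxT : x ∈ T
    · exact hTsing Q hQ x hxT hxi hxj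
    · exact hQX x ((hmemX x).2 ⟨hxi, hxj, hxT⟩)
  have hiX : i ∉ X := by simp [hX]
  have hjX : j ∉ X := by simp [hX]
  obtain ⟨Q₀, hQ₀, hQ₀X, -, hQ₀p⟩ := exists_singletons_of_closed X hcl (mem_movable.1 hP₀).1
  have hQ₀ij : j ∈ Q₀.part i := hQ₀p i j hiX hjX (mem_part_of_mem_movable hP₀)
  have hQ₀sing := hsingX hQ₀ hQ₀X
  have hQ₀mov : Q₀ ∈ movable i j 𝒜 := by
    by_contra h
    have hf := mem_fixing.1 (hstay Q₀ hQ₀ h)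
    rcases hTij with hi | hj
    · exact singleton_notMem_of_mem_part hij hQ₀ij (hf i hi)
    · exact singleton_notMem_of_mem_part hij.symm (mem_part_comm.1 hQ₀ij) (hf j hj)
  have hbot_of : ∀ P : SetPartition n, (∀ x, x ≠ i → x ≠ j → {x} ∈ P.parts) →
      ({i} ∈ P.parts ∨ {j} ∈ P.parts) → P = ⊥ := by
    rintro P hP (hi | hj)
    · refine eq_bot_of_singletons_off j fun x hxj => ?_
      by_cases hxi : x = i
      exacts [hxi ▸ hi, hP x hxi hxj]
    · refine eq_bot_of_singletons_off i fun x hxi => ?_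
      by_cases hxj : x = j
      exacts [hxj ▸ hj, hP x hxi hxj]
  have hbot : (⊥ : SetPartition n) ∉ 𝒜 := by
    rw [← hbot_of (split i j Q₀) (fun x hxi hxj => singleton_mem_split hij (hQ₀sing x hxi hxj))
      (Or.inl (singleton_mem_split_self hij hQ₀ij))]
    exact (mem_movable.1 hQ₀mov).2
  have hallmov : ∀ P ∈ 𝒜, P ∈ movable i j 𝒜 := by
    intro P hP
    by_contra hPm
    have hPT := mem_fixing.1 (hstay P hP hPm)
    -- Splitting off `X` keeps the singleton `{i}` or `{j}` supplied by `T`, so nothing remains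
    -- joined and the result is `⊥`.
    obtain ⟨Q, hQ, hQX, hQs, -⟩ := exists_singletons_of_closed X hcl hP
    refine hbot (hbot_of Q (hsingX hQ hQX) ?_ ▸ hQ)
    exact hTij.imp (fun h => hQs i (hPT i h)) (fun h => hQs j (hPT j h))
  obtain ⟨Q, hQ, hQlt⟩ : ∃ Q ∈ 𝒜, (Q.parts ∩ (⊥ : SetPartition n).parts).card < t := by
    by_contra! h
    -- Otherwise `⊥` could be added, contradicting maximality.
    have h1 : IsNontrivialIntersecting t (insert ⊥ 𝒜) := by
      refine ⟨fun P hP R hR => ?_, fun ⟨S, hS, hSf⟩ =>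
        hnt ⟨S, hS, fun P hP => hSf P (mem_insert_of_mem hP)⟩⟩
      rcases mem_insert.1 hP with rfl | hP <;> rcases mem_insert.1 hR with rfl | hR
      · rw [inter_self, Finpartition.card_bot, card_univ, Fintype.card_fin]
        omega
      · rw [inter_comm]
        exact h R hR
      · exact h P hP
      · exact hint P hP R hR
    have h2 := hmax _ h1
    rw [card_insert_of_notMem hbot] at h2
    omega
  obtain ⟨V, hV, hle⟩ := card_le_of_closed_of_joined hij hint hcl
    (fun P hP => mem_part_of_mem_movable (hallmov P hP))
    (fun P hP x hx hxi hxj => hTsing P hP x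
      (by_contra fun h => hx ((hmemX x).2 ⟨hxi, hxj, h⟩)) hxi hxj) hQ₀ hQ₀sing hQ hQlt
  have := hlarge V hV
  omega
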